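/- Let $K$ be either a number field, or a one-dimensional function field of characteristic $0$ with field of constants $k$ (that is, a finite extension of $k(t)$ with $t$ transcendental over $k$). By a nonarchimedean place of $K$ we mean a valuation ring $V \subsetneq K$ of $K$ which, in the function field case, contains $k$. Let $X_K$ be a smooth projective variety over $K$, let $D_K$ be an effective divisor on $X_K$ with support $|D_K|$, and let $\mathcal Q=(Q_n)_{n\ge 0}$ be a sequence of points in $X_K(K)\smallsetminus |D_K|$. Let $R$ be a Dedekind domain with fraction field $K$ such that the localizations of $R$ at its nonzero primes are nonarchimedean places of $K$ and all but finitely many nonarchimedean places of $K$ arise in this way. Let $X_R$ be a model of $X_K$ over $R$, i.e. a smooth and proper scheme over $\operatorname{Spec} R$ with an identification $X_R\times_R K = X_K$, and let $D_R$ be the closure of $D_K$ in $X_R$. Each $Q\in X_K(K)$ extends uniquely to a section $\sigma_Q:\operatorname{Spec}R\to X_R$. If $Q\notin |D_K|$, write $\sigma_Q^*D_R=\sum_{\mathfrak p} n_{\mathfrak p}(Q,D)\,\mathfrak p$ and $(Q\cdot D)_R=\prod_{\mathfrak p}\mathfrak p^{n_{\mathfrak p}(Q,D)}$; this is the ideal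 of $R$ that defines $\sigma_Q^*D_R$. A nonzero prime $\mathfrak p$ of $R$ is a primitive divisor of $Q_n$ relative to $D$ if $\mathfrak p\mid (Q_n\cdot D)_R$ and $\mathfrak p\nmid (Q_m\cdot D)_R$ for all $0\le m<n$. The Zsigmondy set of $\mathcal Q$ relative to $D$ is $$\mathcal Z=\{n\ge 0 : Q_n \text{ has no primitive divisor relative to } D\}.$$ Let $\mathcal Z$ and $\mathcal Z'$ be the Zsigmondy sets of $\mathcal Q$ relative to $D$ defined using models $X_R$ and $X'_{R'}$ of $X_K$ over two such rings $R$ and $R'$. Then the set $$(\mathcal Z\cup\mathcal Z')\smallsetminus(\mathcal Z\cap\mathcal Z')$$ is finite. In particular, $\mathcal Z$ is finite if and only if $\mathcal Z'$ is finite. -/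

import Mathlib

open AlgebraicGeometry CategoryTheory Limits

universe u

namespace Zsigmondy

/-! ### The base field and its places -/

/-- `K` is a number field (and `C` is the prime ring, generated by `1`), or `K` is a
one-dimensional function field of characteristic zero with field of constants `C`, i.e. a finite
extension of `C(t)` for some `t` transcendental over the field `C`. -/
def IsBaseField (K : Type u) [Field K] (C : Subring K) : Prop :=
  (NumberField K ∧ C = ⊥) ∨
    (CharZero K ∧ ∃ k : Subfield K, k.toSubring = C ∧
      ∃ t : K, Transcendental k t ∧ FiniteDimensional (IntermediateField.adjoin k {t}) K)

/-- The nonarchimedean places of `K`, as nontrivial valuation rings of `K` that contain `C`. In the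
function field case these are the valuations that are trivial on the constants. -/
def IsPlace {K : Type u} [Field K] (C : Subring K) (V : ValuationSubring K) : Prop :=
  V ≠ ⊤ ∧ C ≤ V.toSubring

/-- The valuation ring in `K` of a nonzero prime of a Dedekind domain `R` with fraction
field `K`. -/
noncomputable def placeOf {R : Type u} (K : Type u) [CommRing R] [IsDedekindDomain R] [Field K]
    [Algebra R K] [IsFractionRing R K] (𝔭 : IsDedekindDomain.HeightOneSpectrum R) :
    ValuationSubring K :=
  (𝔭.valuation K).valuationSubring

/-- The nonzero primes of `R` are places of `K`, and all but finitely many nonarchimedean places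
of `K` come from `Spec R`. -/
structure HasAlmostAllPlaces {K : Type u} [Field K] (C : Subring K) (R : Type u) [CommRing R]
    [IsDedekindDomain R] [Algebra R K] [IsFractionRing R K] : Prop where
  isPlace : ∀ 𝔭 : IsDedekindDomain.HeightOneSpectrum R, IsPlace C (placeOf K 𝔭)
  finite_compl : {V : ValuationSubring K | IsPlace C V ∧
    ∀ 𝔭 : IsDedekindDomain.HeightOneSpectrum R, V ≠ placeOf K 𝔭}.Finite

/-! ### Smooth projective varieties and divisors -/

section ProjectiveSpace

attribute [local instance] MvPolynomial.gradedAlgebra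

/-- Projective `n`-space over `K`, as `Proj K[x₀, …, xₙ]`. -/
noncomputable def projectiveSpace (K : Type u) [Field K] (n : ℕ) : Scheme.{u} :=
  Proj (MvPolynomial.homogeneousSubmodule (Fin (n + 1)) K)

/-- The structure morphism of projective space. -/
noncomputable def projectiveSpaceToSpec (K : Type u) [Field K] (n : ℕ) :
    projectiveSpace K n ⟶ Spec (.of K) :=
  Proj.toSpecZero (MvPolynomial.homogeneousSubmodule (Fin (n + 1)) K) ≫
    Spec.map (CommRingCat.ofHom
      (algebraMap K (MvPolynomial.homogeneousSubmodule (Fin (n + 1)) K 0)))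

end ProjectiveSpace

/-- A smooth projective variety over `K`: an integral scheme, smooth over `K`, that is a closed
subscheme of some projective space over `K`. -/
structure IsSmoothProjectiveVariety {K : Type u} [Field K] {X : Scheme.{u}}
    (p : X ⟶ Spec (.of K)) : Prop where
  isIntegral : IsIntegral X
  smooth : Smooth p
  projective : ∃ (n : ℕ) (i : X ⟶ projectiveSpace K n),
    IsClosedImmersion i ∧ i ≫ projectiveSpaceToSpec K n = p

/-- An effective (Cartier) divisor, given by its ideal sheaf: locally the ideal sheaf is generated
by a single nonzerodivisor. On a smooth variety these are the same as effective Weil divisors. -/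
def IsEffectiveDivisor {X : Scheme.{u}} (D : X.IdealSheafData) : Prop :=
  ∀ x : X, ∃ U : X.affineOpens, x ∈ U.1 ∧
    ∃ f ∈ nonZeroDivisors Γ(X, U.1), D.ideal U = Ideal.span {f}

/-- The set `X(K)` of `K`-rational points. -/
def RationalPoint {K : Type u} [Field K] {X : Scheme.{u}} (p : X ⟶ Spec (.of K)) : Type u :=
  {q : Spec (.of K) ⟶ X // q ≫ p = 𝟙 _}

/-- The rational point `Q` does not lie on the support `|D|`. -/
def RationalPoint.NotMemSupport {K : Type u} [Field K] {X : Scheme.{u}} {p : X ⟶ Spec (.of K)}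
    (Q : RationalPoint p) (D : X.IdealSheafData) : Prop :=
  ∀ t : Spec (.of K), Q.1 t ∉ D.support

/-! ### Extending rational points to sections -/

theorem isDominant_of_comp_openImmersion {T V S : Scheme.{u}} (ι : T ⟶ V) (j : V ⟶ S)
    [IsOpenImmersion j] [h : IsDominant (ι ≫ j)] : IsDominant ι := by
  rw [isDominant_iff] at h ⊢
  have h2 := Dense.preimage h j.isOpenEmbedding.isOpenMap
  refine h2.mono ?_
  rintro y ⟨t, ht⟩
  refine ⟨t, j.isOpenEmbedding.injective ?_⟩
  simpa using ht


theorem isDominant_specMap_fractionRing {R K : Type u} [CommRing R] [IsDedekindDomain R] [Field K] [Algebra R K]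
    [IsFractionRing R K] :
    IsDominant (Spec.map (CommRingCat.ofHom (algebraMap R K))) := by
  rw [isDominant_iff]
  refine (PrimeSpectrum.denseRange_comap_iff_ker_le_nilRadical (algebraMap R K)).mpr ?_
  rw [(RingHom.injective_iff_ker_eq_bot _).mp (IsFractionRing.injective R K)]
  exact bot_le

/-- The valuative criterion over the local ring `V` of `R` at a prime `P`. -/
theorem valuative_lift {R K : Type u} [CommRing R] [IsDedekindDomain R] [Field K] [Algebra R K]
    [IsFractionRing R K]
    {X : Scheme.{u}} (π : X ⟶ Spec (.of R)) [IsProper π]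
    (q : Spec (.of K) ⟶ X) (hq : q ≫ π = Spec.map (CommRingCat.ofHom (algebraMap R K)))
    (P : Ideal R) [P.IsPrime] (V : CommRingCat.{u}) (φ : CommRingCat.of R ⟶ V)
    (hV : @IsLocalization.AtPrime R _ V _ φ.hom.toAlgebra P _) :
    ∃ (l : Spec V ⟶ X) (a : V ⟶ CommRingCat.of K),
      φ ≫ a = CommRingCat.ofHom (algebraMap R K) ∧ l ≫ π = Spec.map φ ∧ Spec.map a ≫ l = q := by
  let : Algebra R V := φ.hom.toAlgebra
  have : IsLocalization.AtPrime V P := hV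
  have : IsDomain V := IsLocalization.isDomain_of_le_nonZeroDivisors _
    P.primeCompl_le_nonZeroDivisors
  let : Algebra V K := IsLocalization.localizationAlgebraOfSubmonoidLe V K P.primeCompl
    (nonZeroDivisors R) P.primeCompl_le_nonZeroDivisors
  have : IsScalarTower R V K := IsLocalization.localization_isScalarTower_of_submonoid_le V K _ _
    P.primeCompl_le_nonZeroDivisors
  have : IsFractionRing V K :=
    IsFractionRing.isFractionRing_of_isDomain_of_isLocalization P.primeCompl V K
  have : ValuationRing V := by
    have : IsDedekindDomain V := IsLocalization.AtPrime.isDedekindDomain R P V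
    have : IsLocalRing V := IsLocalization.AtPrime.isLocalRing V P
    by_cases hP : P = ⊥
    · subst hP
      have : IsFractionRing R V := by
        have h : (⊥ : Ideal R).primeCompl = nonZeroDivisors R := by
          ext; simp [Ideal.primeCompl]
        rw [IsFractionRing, ← h]
        exact hV
      let := IsFractionRing.toField R (K := V)
      infer_instance
    · have := IsLocalization.AtPrime.isDiscreteValuationRing_of_dedekind_domain R hP V
      infer_instance
  have hφ : φ ≫ CommRingCat.ofHom (algebraMap V K) = CommRingCat.ofHom (algebraMap R K) := by
    rw [IsScalarTower.algebraMap_eq R V K, CommRingCat.ofHom_comp]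
    rfl
  have hval : ValuativeCriterion π := by
    have : IsProper π := inferInstance
    rw [IsProper.eq_valuativeCriterion] at this
    exact this.1.1.1
  obtain ⟨l, hl₁, hl₂⟩ := (hval.existence
    ⟨V, K, q, Spec.map φ, ⟨by
      rw [hq, ← hφ, Spec.map_comp]⟩⟩).exists_lift.some
  exact ⟨l, CommRingCat.ofHom (algebraMap V K), hφ, hl₂, hl₁⟩

/-- Near every point of `Spec R`, a `K`-point of a proper `R`-scheme extends to a local section. -/
theorem local_extension {R K : Type u} [CommRing R] [IsDedekindDomain R] [Field K] [Algebra R K]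
    [IsFractionRing R K]
    {X : Scheme.{u}} (π : X ⟶ Spec (.of R)) [IsProper π]
    (q : Spec (.of K) ⟶ X) (hq : q ≫ π = Spec.map (CommRingCat.ofHom (algebraMap R K)))
    (x : Spec (.of R)) :
    ∃ (U : (Spec (.of R)).Opens) (_ : x ∈ U) (f : U.toScheme ⟶ X), f ≫ π = U.ι ∧
      ∀ g : Spec (.of K) ⟶ U, g ≫ U.ι = Spec.map (CommRingCat.ofHom (algebraMap R K)) →
        g ≫ f = q := by
  let P : PrimeSpectrum R := x
  have hstalk := Spec.fromSpecStalk_eq (.of R) x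
  obtain ⟨l, a, ha, hl₁, hl₂⟩ := valuative_lift π q hq P.asIdeal ((Spec (.of R)).presheaf.stalk x)
    ((Scheme.ΓSpecIso (.of R)).inv ≫ (Spec (.of R)).presheaf.germ ⊤ x trivial)
    (StructureSheaf.IsLocalization.to_stalk R P)
  rw [← hstalk] at hl₁
  obtain ⟨U, hxU, f, hf₁, hf₂⟩ := spread_out_of_isGermInjective' (𝟙 (Spec (.of R))) π (x := x) l
    (by rw [Category.comp_id]; exact hl₁)
  refine ⟨U, hxU, f, by simpa using hf₂, fun g hg => ?_⟩
  have : g = Spec.map a ≫ U.fromSpecStalkOfMem x hxU := by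
    rw [← cancel_mono U.ι, hg, Category.assoc, Scheme.Opens.fromSpecStalkOfMem_ι, hstalk,
      ← Spec.map_comp, ha]
  rw [this, Category.assoc, ← hf₁]
  exact hl₂

/-- A `K`-point of a scheme proper over a Dedekind domain `R` with fraction field `K` extends
uniquely to a section over `Spec R`. -/
theorem existsUnique_section {R K : Type u} [CommRing R] [IsDedekindDomain R] [Field K] [Algebra R K]
    [IsFractionRing R K]
    {X : Scheme.{u}} (π : X ⟶ Spec (.of R)) [IsProper π]
    (q : Spec (.of K) ⟶ X) (hq : q ≫ π = Spec.map (CommRingCat.ofHom (algebraMap R K))) :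
    ∃! σ : Spec (.of R) ⟶ X,
      σ ≫ π = 𝟙 _ ∧ Spec.map (CommRingCat.ofHom (algebraMap R K)) ≫ σ = q := by
  choose U hU f hf hfq using local_extension π q hq
  have hcov : TopologicalSpace.IsOpenCover U := by
    rw [TopologicalSpace.IsOpenCover, eq_top_iff]
    exact fun x _ => TopologicalSpace.Opens.mem_iSup.mpr ⟨x, hU x⟩
  let 𝒰 := (Spec (.of R)).openCoverOfIsOpenCover U hcov
  let g := Spec.map (CommRingCat.ofHom (algebraMap R K))
  have hgd : IsDominant g := isDominant_specMap_fractionRing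
  have hrange (x) : Set.range g ⊆ Set.range (U x).ι := by
    rintro _ ⟨t, rfl⟩
    obtain ⟨s, hs⟩ := (isDominant_iff _).mp hgd |>.exists_mem_open (U x).2 ⟨x, hU x⟩
    rw [Scheme.Opens.range_ι, Subsingleton.elim (α := PrimeSpectrum K) t s]
    exact hs
  let gl (x) : Spec (.of K) ⟶ U x := IsOpenImmersion.lift (U x).ι g (hrange x)
  have hgl (x) : gl x ≫ (U x).ι = g := IsOpenImmersion.lift_fac _ _ _
  have hglf (x) : gl x ≫ f x = q := hfq x _ (hgl x)
  have hglue : ∀ x y : Spec (.of R), pullback.fst (U x).ι (U y).ι ≫ f x =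
      pullback.snd (U x).ι (U y).ι ≫ f y := by
    intro x y
    let w : Spec (.of K) ⟶ pullback (U x).ι (U y).ι :=
      pullback.lift (gl x) (gl y) ((hgl x).trans (hgl y).symm)
    have : IsDominant (w ≫ pullback.fst (U x).ι (U y).ι ≫ (U x).ι) := by
      rw [pullback.lift_fst_assoc, hgl]
      exact hgd
    have : IsDominant w := isDominant_of_comp_openImmersion w
      (pullback.fst (U x).ι (U y).ι ≫ (U x).ι)
    have : AlgebraicGeometry.IsReduced (pullback (U x).ι (U y).ι) :=
      isReduced_of_isOpenImmersion (pullback.fst (U x).ι (U y).ι ≫ (U x).ι)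
    refine ext_of_isDominant_of_isSeparated π ?_ w ?_
    · rw [Category.assoc, Category.assoc, hf, hf, pullback.condition]
    · rw [pullback.lift_fst_assoc, pullback.lift_snd_assoc, hglf, hglf]
  obtain ⟨σ, hσ⟩ : ∃ σ : Spec (.of R) ⟶ X, ∀ x, (U x).ι ≫ σ = f x :=
    ⟨𝒰.glueMorphisms f hglue, Scheme.Cover.ι_glueMorphisms 𝒰 f hglue⟩
  refine ⟨σ, ⟨?_, ?_⟩, ?_⟩
  · refine 𝒰.hom_ext _ _ fun x => ?_
    change (U x).ι ≫ σ ≫ π = (U x).ι ≫ 𝟙 _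
    rw [reassoc_of% (hσ x), Category.comp_id]
    exact hf x
  · let x₀ : Spec (.of R) := (⊥ : PrimeSpectrum R)
    change g ≫ σ = q
    rw [← hgl x₀, ← hglf x₀, Category.assoc, hσ]
  · rintro τ ⟨h₁, h₂⟩
    refine ext_of_isDominant_of_isSeparated π ?_ g ?_
    · rw [h₁]
      refine 𝒰.hom_ext _ _ fun x => ?_
      change (U x).ι ≫ 𝟙 _ = (U x).ι ≫ σ ≫ π
      rw [reassoc_of% (hσ x), Category.comp_id]
      exact (hf x).symm
    · let x₀ : Spec (.of R) := (⊥ : PrimeSpectrum R)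
      change g ≫ τ = g ≫ σ
      rw [show g ≫ τ = q from h₂, ← hgl x₀, Category.assoc, hσ, hglf]

/-! ### Integral models and Zsigmondy sets -/

/-- A model of `X / K` over `R`: a scheme that is smooth and proper over `Spec R`, with an
identification of its generic fibre with `X`. -/
structure IntegralModel {K : Type u} [Field K] {X : Scheme.{u}} (p : X ⟶ Spec (.of K))
    (R : Type u) [CommRing R] [Algebra R K] where
  /-- The total space `X_R`. -/
  scheme : Scheme.{u}
  /-- The structure morphism `X_R ⟶ Spec R`. -/
  toSpec : scheme ⟶ Spec (.of R)
  smooth : Smooth toSpec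
  proper : IsProper toSpec
  /-- The projection `X = X_R ×_R K ⟶ X_R`. -/
  generic : X ⟶ scheme
  isPullback : IsPullback generic p toSpec (Spec.map (CommRingCat.ofHom (algebraMap R K)))

namespace IntegralModel

variable {K : Type u} [Field K] {X : Scheme.{u}} {p : X ⟶ Spec (.of K)}
  {R : Type u} [CommRing R] [IsDedekindDomain R] [Algebra R K] [IsFractionRing R K]

/-- `D_R`, the (scheme-theoretic) closure of `D` in `X_R`, i.e. the scheme-theoretic image of `D`
under `X ⟶ X_R`, given by its ideal sheaf. -/
noncomputable def closure (M : IntegralModel p R) (D : X.IdealSheafData) :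
    M.scheme.IdealSheafData :=
  D.map M.generic

theorem existsUnique_extension (M : IntegralModel p R) (Q : RationalPoint p) :
    ∃! σ : Spec (.of R) ⟶ M.scheme, σ ≫ M.toSpec = 𝟙 _ ∧
      Spec.map (CommRingCat.ofHom (algebraMap R K)) ≫ σ = Q.1 ≫ M.generic :=
  haveI := M.proper
  existsUnique_section M.toSpec (Q.1 ≫ M.generic) (by
    rw [Category.assoc, M.isPullback.w, ← Category.assoc, Q.2, Category.id_comp])

/-- `σ_Q : Spec R ⟶ X_R`, the section of the model that extends the rational point `Q`. -/
noncomputable def extension (M : IntegralModel p R) (Q : RationalPoint p) :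
    Spec (.of R) ⟶ M.scheme :=
  (M.existsUnique_extension Q).choose

theorem extension_spec (M : IntegralModel p R) (Q : RationalPoint p) :
    M.extension Q ≫ M.toSpec = 𝟙 _ ∧
      Spec.map (CommRingCat.ofHom (algebraMap R K)) ≫ M.extension Q = Q.1 ≫ M.generic :=
  (M.existsUnique_extension Q).choose_spec.1

/-- The arithmetic intersection ideal `(Q · D)_R`: the ideal of `R` that defines the divisor
`σ_Q^* D_R` on `Spec R`. If that divisor is `∑ n_𝔭 𝔭`, this ideal is `∏ 𝔭 ^ n_𝔭`. -/
noncomputable def intersectionIdeal (M : IntegralModel p R) (D : X.IdealSheafData)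
    (Q : RationalPoint p) : Ideal R :=
  (((M.closure D).comap (M.extension Q)).ideal ⟨⊤, isAffineOpen_top _⟩).comap
    (Scheme.ΓSpecIso (.of R)).inv.hom

/-- `𝔭` is a primitive prime divisor of `Q n` relative to `D`. -/
def IsPrimitiveDivisor (M : IntegralModel p R) (D : X.IdealSheafData) (Q : ℕ → RationalPoint p)
    (n : ℕ) (𝔭 : IsDedekindDomain.HeightOneSpectrum R) : Prop :=
  𝔭.asIdeal ∣ M.intersectionIdeal D (Q n) ∧ ∀ m < n, ¬ 𝔭.asIdeal ∣ M.intersectionIdeal D (Q m)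

/-- The Zsigmondy set of the sequence `Q` relative to `D`, computed with the model `M`. -/
def zsigmondySet (M : IntegralModel p R) (D : X.IdealSheafData) (Q : ℕ → RationalPoint p) :
    Set ℕ :=
  {n | ¬ ∃ 𝔭 : IsDedekindDomain.HeightOneSpectrum R, M.IsPrimitiveDivisor D Q n 𝔭}

end IntegralModel

end Zsigmondy

namespace Zsigmondy

/-! A prime is a primitive divisor of at most one `Q n`, so finitely many primes affect only
finitely many indices. It therefore suffices that, outside finitely many places and uniformly in the
rational point `Q`, the two models agree on whether a place divides the intersection ideal, that is,
on whether the section through `Q` meets the closure of `D` there.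

Away from finitely many primes both models live over one Noetherian ring `T = R[1/f]` that also
contains `R'`. Let `A` and `B` be their base changes to `T`, and let `W` be the set of points of `A
×_T B` in the closure of the diagonally embedded generic fibre `X` that lie over the closure of `D`
in `A` but not in `B`. By Chevalley the image of `W` in `Spec T` is constructible. It misses the
generic point, because `X` is already closed in the generic fibre of the product, so it lies in the
zero locus of some `g ≠ 0` (`exists_ne_zero_of_preimage_subset`). The two sections through `Q`
together map `Spec T` into the closure of `X`, so the models can disagree in this direction only at
primes containing `g`, which does not depend on `Q`. Exchanging the models gives the other
direction. -/

/-! ### Constructible sets at the generic point, and the closure of the diagonal -/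

/-- The alternative holds for open sets since `η` is generic, is symmetric under complements, and
passes to unions by intersecting the two neighbourhoods. -/
theorem exists_isOpen_disjoint_of_isConstructible {S : Type*} [TopologicalSpace S] {η : S}
    (hη : ∀ U : Set S, IsOpen U → U.Nonempty → η ∈ U) {s : Set S}
    (hs : Topology.IsConstructible s) :
    ∃ U : Set S, IsOpen U ∧ η ∈ U ∧ (U ⊆ s ∨ Disjoint U s) := by
  induction hs using Topology.IsConstructible.empty_union_induction with
  | open_retrocompact U hU _ =>
    rcases U.eq_empty_or_nonempty with rfl | hne
    · exact ⟨Set.univ, isOpen_univ, trivial, .inr (Set.disjoint_empty _)⟩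
    · exact ⟨U, hU, hη U hU hne, .inl subset_rfl⟩
  | union s _ t _ hs ht =>
    obtain ⟨U, hU, hηU, h⟩ := hs
    obtain ⟨V, hV, hηV, h'⟩ := ht
    refine ⟨U ∩ V, hU.inter hV, ⟨hηU, hηV⟩, ?_⟩
    rcases h with h | h
    · exact .inl ((Set.inter_subset_left.trans h).trans Set.subset_union_left)
    rcases h' with h' | h'
    · exact .inl ((Set.inter_subset_right.trans h').trans Set.subset_union_right)
    · exact .inr (Set.disjoint_union_right.mpr
        ⟨h.mono_left Set.inter_subset_left, h'.mono_left Set.inter_subset_right⟩)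
  | compl s _ hs =>
    obtain ⟨U, hU, hηU, h⟩ := hs
    refine ⟨U, hU, hηU, ?_⟩
    rcases h with h | h
    · exact .inr (Set.disjoint_compl_right_iff_subset.mpr h)
    · exact .inl h.subset_compl_right

theorem exists_ne_zero_of_isConstructible {T : Type u} [CommRing T] [IsDomain T]
    {s : Set (PrimeSpectrum T)} (hs : Topology.IsConstructible s)
    (hη : (⊥ : PrimeSpectrum T) ∉ s) :
    ∃ g : T, g ≠ 0 ∧ ∀ x ∈ s, g ∈ x.asIdeal := by
  obtain ⟨U, hU, hηU, h⟩ := exists_isOpen_disjoint_of_isConstructible (η := (⊥ : PrimeSpectrum T))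
    (fun U hU ⟨x, hx⟩ => ((PrimeSpectrum.le_iff_specializes _ _).mp bot_le).mem_open hU hx) hs
  have h : Disjoint U s := h.resolve_left fun h => hη (h hηU)
  obtain ⟨_, ⟨g, rfl⟩, hg, hgU⟩ :=
    PrimeSpectrum.isTopologicalBasis_basic_opens.exists_subset_of_mem_open hηU hU
  refine ⟨g, ?_, fun x hx => ?_⟩
  · simpa using hg
  · by_contra hgx
    exact Set.disjoint_left.mp h (hgU hgx) hx

/-- The points of `A ×_T B` in the closure of the diagonal of the common generic fibre `X` that lie
over a closed subset `F` of `A` but not over a closed subset `F'` of `B` map to a proper closed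
subset of `Spec T`, if `F` is contained in `F'` on the generic fibre. -/
theorem exists_ne_zero_of_preimage_subset {T K : Type u} [CommRing T] [IsDomain T]
    [IsNoetherianRing T] [Field K] [Algebra T K] [IsFractionRing T K] {X A B : Scheme.{u}}
    {p : X ⟶ Spec (.of K)} {a : A ⟶ Spec (.of T)} {b : B ⟶ Spec (.of T)}
    [LocallyOfFinitePresentation a] [IsProper a] [LocallyOfFinitePresentation b] [IsProper b]
    {i : X ⟶ A} {j : X ⟶ B}
    (hi : IsPullback i p a (Spec.map (CommRingCat.ofHom (algebraMap T K))))
    (hj : IsPullback j p b (Spec.map (CommRingCat.ofHom (algebraMap T K))))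
    {F : Set A} (hF : IsClosed F) {F' : Set B} (hF' : IsClosed F') (hFF' : i ⁻¹' F ⊆ j ⁻¹' F') :
    ∃ g : T, g ≠ 0 ∧ ∀ y : (pullback a b :),
      y ∈ closure (Set.range (pullback.lift i j (hi.w.trans hj.w.symm))) →
      pullback.fst a b y ∈ F → pullback.snd a b y ∉ F' →
      g ∈ PrimeSpectrum.asIdeal ((pullback.fst a b ≫ a) y) := by
  let δ := pullback.lift i j (hi.w.trans hj.w.symm)
  let Y := pullback a b
  let c : Y ⟶ Spec (.of T) := pullback.fst a b ≫ a
  have : IsNoetherianRing (CommRingCat.of T) := inferInstanceAs (IsNoetherianRing T)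
  have : IsNoetherian Y :=
    { toIsLocallyNoetherian := LocallyOfFiniteType.isLocallyNoetherian c
      toCompactSpace := QuasiCompact.compactSpace_of_compactSpace c }
  -- All open subsets of a Noetherian space are compact, so closed sets are constructible as well.
  have hcl {s : Set Y} (hs : IsClosed s) : Topology.IsConstructible s :=
    Topology.isConstructible_compl.mp ((TopologicalSpace.NoetherianSpace.isCompact _).isConstructible
      hs.isOpen_compl)
  let W : Set Y := (closure (Set.range δ) ∩ pullback.fst a b ⁻¹' F) ∩ (pullback.snd a b ⁻¹' F')ᶜ
  have hW : Topology.IsConstructible W :=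
    ((hcl isClosed_closure).inter (hcl (hF.preimage (pullback.fst a b).continuous))).inter
      (hcl (hF'.preimage (pullback.snd a b).continuous)).compl
  -- Chevalley's theorem makes the image of `W` constructible; what remains is that no point of `W`
  -- lies over the generic point of `Spec T`.
  obtain ⟨g, hg, h⟩ := exists_ne_zero_of_isConstructible (c.isConstructible_image hW) (by
    rintro ⟨y, ⟨⟨hy, hyF⟩, hyF'⟩, hyη⟩
    let e := Spec.map (CommRingCat.ofHom (algebraMap T K))
    have : IsPreimmersion e := IsPreimmersion.of_isLocalization (nonZeroDivisors T)
    obtain ⟨z, rfl⟩ : y ∈ Set.range (pullback.fst c e) := by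
      rw [Scheme.Pullback.range_fst]
      refine ⟨(⊥ : PrimeSpectrum K), hyη.symm ▸ ?_⟩
      refine PrimeSpectrum.ext ?_
      change RingHom.ker (algebraMap T K) = ⊥
      exact (RingHom.injective_iff_ker_eq_bot _).mp (IsFractionRing.injective T K)
    have hδc : δ ≫ c = p ≫ e := by
      rw [← hi.w, ← Category.assoc, pullback.lift_fst]
    let d : X ⟶ pullback c e := pullback.lift δ p hδc
    let r : pullback c e ⟶ X := hi.lift (pullback.fst c e ≫ pullback.fst a b) (pullback.snd c e)
      (by rw [Category.assoc]; exact pullback.condition)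
    -- A section of a separated morphism is a closed immersion, so `X` is closed in the generic
    -- fibre of `Y`.
    have hdr : d ≫ r = 𝟙 X := by
      refine hi.hom_ext ?_ ?_
      · rw [Category.assoc, hi.lift_fst, pullback.lift_fst_assoc, pullback.lift_fst,
          Category.id_comp]
      · rw [Category.assoc, hi.lift_snd, pullback.lift_snd, Category.id_comp]
    have : IsSeparated (r ≫ p) := by
      rw [hi.lift_snd]
      infer_instance
    have : IsSeparated r := IsSeparated.of_comp r p
    have : IsClosedImmersion (d ≫ r) := by
      rw [hdr]
      infer_instance
    have : IsClosedImmersion d := IsClosedImmersion.of_comp d r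
    -- The generic fibre carries the subspace topology of `Y`, so closures in it are traces of
    -- closures in `Y`.
    have hz : z ∈ closure (Set.range d) := by
      rw [(pullback.fst c e).isEmbedding.isInducing.closure_eq_preimage_closure_image,
        ← Set.range_comp]
      rwa [show (pullback.fst c e ∘ d : X → Y) = δ from
        funext fun x => by rw [Function.comp_apply, ← Scheme.Hom.comp_apply, pullback.lift_fst]]
    rw [d.isClosedEmbedding.isClosed_range.closure_eq] at hz
    obtain ⟨x, rfl⟩ := hz
    simp only [← Scheme.Hom.comp_apply, Set.mem_preimage, Set.mem_compl_iff, d, δ,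
      pullback.lift_fst, pullback.lift_snd] at hyF hyF'
    exact hyF' (hFF' hyF))
  exact ⟨g, hg, fun y hy hyF hyF' => h _ ⟨y, ⟨⟨hy, hyF⟩, hyF'⟩, rfl⟩⟩

/-- The base change of a model has the same generic fibre. -/
theorem IntegralModel.isPullback_lift {K : Type u} [Field K] {X : Scheme.{u}}
    {p : X ⟶ Spec (.of K)} {R : Type u} [CommRing R] [Algebra R K] (M : IntegralModel p R)
    (T : Type u) [CommRing T] [Algebra T K] [Algebra R T] [IsScalarTower R T K]
    (h : M.generic ≫ M.toSpec = (p ≫ Spec.map (CommRingCat.ofHom (algebraMap T K))) ≫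
      Spec.map (CommRingCat.ofHom (algebraMap R T))) :
    IsPullback (pullback.lift M.generic (p ≫ Spec.map (CommRingCat.ofHom (algebraMap T K))) h) p
      (pullback.snd M.toSpec (Spec.map (CommRingCat.ofHom (algebraMap R T))))
      (Spec.map (CommRingCat.ofHom (algebraMap T K))) := by
  refine IsPullback.of_right (h₁₂ := pullback.fst _ _) ?_ (pullback.lift_snd _ _ _)
    (IsPullback.of_hasPullback _ _)
  rw [pullback.lift_fst, ← Spec.map_comp, ← CommRingCat.ofHom_comp,
    ← IsScalarTower.algebraMap_eq R T K]
  exact M.isPullback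

/-! ### Divisibility as incidence of sections with closed sets -/

section

variable {K : Type u} [Field K] {X : Scheme.{u}} {p : X ⟶ Spec (.of K)}
  {R : Type u} [CommRing R] [Algebra R K] [IsFractionRing R K]

instance (M : IntegralModel p R) : IsPreimmersion M.generic :=
  haveI : IsPreimmersion (Spec.map (CommRingCat.ofHom (algebraMap R K))) :=
    IsPreimmersion.of_isLocalization (nonZeroDivisors R)
  MorphismProperty.of_isPullback M.isPullback.flip this

instance (M : IntegralModel p R) : QuasiCompact M.generic :=
  MorphismProperty.of_isPullback (P := @QuasiCompact) M.isPullback.flip inferInstance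

/-- The support of the scheme-theoretic closure is the topological closure of the image, by
quasi-compactness of `M.generic`; as `M.generic` is an embedding, it adds no points on the generic
fibre. -/
theorem IntegralModel.preimage_support_closure (M : IntegralModel p R) (D : X.IdealSheafData) :
    M.generic ⁻¹' (M.closure D).support = D.support := by
  rw [IntegralModel.closure, Scheme.IdealSheafData.support_map,
    TopologicalSpace.Closeds.coe_closure,
    ← M.generic.isEmbedding.isInducing.closure_eq_preimage_closure_image,
    D.support.isClosed.closure_eq]

variable [IsDedekindDomain R]

theorem IntegralModel.dvd_intersectionIdeal_iff (M : IntegralModel p R) (D : X.IdealSheafData)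
    (Q : RationalPoint p) (𝔭 : PrimeSpectrum R) :
    𝔭.asIdeal ∣ M.intersectionIdeal D Q ↔ M.extension Q 𝔭 ∈ (M.closure D).support := by
  have h := Scheme.IdealSheafData.support_comap (M.closure D) (M.extension Q)
  have h' : M.extension Q 𝔭 ∈ (M.closure D).support ↔
      (show Spec (.of R) from 𝔭) ∈ ((M.closure D).comap (M.extension Q)).support := by
    rw [h]; rfl
  rw [h', Scheme.IdealSheafData.mem_support_iff_of_mem (U := ⟨⊤, isAffineOpen_top _⟩) trivial,
    Ideal.dvd_iff_le, Spec_zeroLocus]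
  rfl

/-- Over all primes of `T` that avoid a suitable nonzero element, the sections of two models
meet the closures of `D` simultaneously. -/
theorem IntegralModel.exists_ne_zero_of_mem_support
    {R' : Type u} [CommRing R'] [IsDedekindDomain R'] [Algebra R' K] [IsFractionRing R' K]
    (T : Type u) [CommRing T] [IsDomain T] [IsNoetherianRing T] [Algebra T K] [IsFractionRing T K]
    [Algebra R T] [IsScalarTower R T K] [Algebra R' T] [IsScalarTower R' T K]
    (M : IntegralModel p R) (M' : IntegralModel p R') (D : X.IdealSheafData) :
    ∃ g : T, g ≠ 0 ∧ ∀ (Q : RationalPoint p) (t : PrimeSpectrum T), g ∉ t.asIdeal →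
      M.extension Q (t.comap (algebraMap R T)) ∈ (M.closure D).support →
      M'.extension Q (t.comap (algebraMap R' T)) ∈ (M'.closure D).support := by
  have := M.proper
  have := M'.proper
  have := M.smooth
  have := M'.smooth
  let e := Spec.map (CommRingCat.ofHom (algebraMap T K))
  let ρ := Spec.map (CommRingCat.ofHom (algebraMap R T))
  let ρ' := Spec.map (CommRingCat.ofHom (algebraMap R' T))
  have hρ : e ≫ ρ = Spec.map (CommRingCat.ofHom (algebraMap R K)) := by
    rw [← Spec.map_comp, ← CommRingCat.ofHom_comp, ← IsScalarTower.algebraMap_eq R T K]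
  have hρ' : e ≫ ρ' = Spec.map (CommRingCat.ofHom (algebraMap R' K)) := by
    rw [← Spec.map_comp, ← CommRingCat.ofHom_comp, ← IsScalarTower.algebraMap_eq R' T K]
  have h : M.generic ≫ M.toSpec = (p ≫ e) ≫ ρ := by
    rw [Category.assoc, hρ, M.isPullback.w]
  have h' : M'.generic ≫ M'.toSpec = (p ≫ e) ≫ ρ' := by
    rw [Category.assoc, hρ', M'.isPullback.w]
  have hi := M.isPullback_lift T h
  have hj := M'.isPullback_lift T h'
  have hsub : pullback.lift M.generic (p ≫ e) h ⁻¹' (pullback.fst M.toSpec ρ ⁻¹'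
      (M.closure D).support) ⊆ pullback.lift M'.generic (p ≫ e) h' ⁻¹'
        (pullback.fst M'.toSpec ρ' ⁻¹' (M'.closure D).support) := by
    intro x hx
    simp only [Set.mem_preimage, ← Scheme.Hom.comp_apply, pullback.lift_fst] at hx ⊢
    have hx : x ∈ M.generic ⁻¹' (M.closure D).support := hx
    rw [M.preimage_support_closure, ← M'.preimage_support_closure] at hx
    exact hx
  obtain ⟨g, hg, H⟩ := exists_ne_zero_of_preimage_subset hi hj
    ((M.closure D).support.isClosed.preimage (pullback.fst M.toSpec ρ).continuous)
    ((M'.closure D).support.isClosed.preimage (pullback.fst M'.toSpec ρ').continuous) hsub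
  refine ⟨g, hg, fun Q t hgt hQ => ?_⟩
  let s : Spec (.of T) ⟶ pullback M.toSpec ρ := pullback.lift (ρ ≫ M.extension Q) (𝟙 _) (by
    rw [Category.assoc, (M.extension_spec Q).1, Category.comp_id, Category.id_comp])
  let s' : Spec (.of T) ⟶ pullback M'.toSpec ρ' := pullback.lift (ρ' ≫ M'.extension Q) (𝟙 _) (by
    rw [Category.assoc, (M'.extension_spec Q).1, Category.comp_id, Category.id_comp])
  have hs : e ≫ s = Q.1 ≫ pullback.lift M.generic (p ≫ e) h := by
    refine pullback.hom_ext ?_ ?_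
    · rw [Category.assoc, Category.assoc, pullback.lift_fst, pullback.lift_fst, reassoc_of% hρ,
        (M.extension_spec Q).2]
    · rw [Category.assoc, Category.assoc, pullback.lift_snd, pullback.lift_snd, reassoc_of% Q.2,
        Category.comp_id]
  have hs' : e ≫ s' = Q.1 ≫ pullback.lift M'.generic (p ≫ e) h' := by
    refine pullback.hom_ext ?_ ?_
    · rw [Category.assoc, Category.assoc, pullback.lift_fst, pullback.lift_fst, reassoc_of% hρ',
        (M'.extension_spec Q).2]
    · rw [Category.assoc, Category.assoc, pullback.lift_snd, pullback.lift_snd, reassoc_of% Q.2,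
        Category.comp_id]
  -- The pair of sections through `Q`; on the generic point it factors through the diagonal `X`.
  let τ := pullback.lift s s' ((pullback.lift_snd _ _ _).trans (pullback.lift_snd _ _ _).symm)
  have hτ : e ≫ τ = Q.1 ≫ pullback.lift _ _ (hi.w.trans hj.w.symm) := by
    refine pullback.hom_ext ?_ ?_
    · rw [Category.assoc, Category.assoc, pullback.lift_fst, pullback.lift_fst, hs]
    · rw [Category.assoc, Category.assoc, pullback.lift_snd, pullback.lift_snd, hs']
  by_contra hcon
  have hdense : DenseRange e := by
    refine (PrimeSpectrum.denseRange_comap_iff_ker_le_nilRadical (algebraMap T K)).mpr ?_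
    rw [(RingHom.injective_iff_ker_eq_bot _).mp (IsFractionRing.injective T K)]
    exact bot_le
  have hfst (x : Spec (.of T)) : pullback.fst M.toSpec ρ
      (pullback.fst (pullback.snd M.toSpec ρ) (pullback.snd M'.toSpec ρ') (τ x)) =
      M.extension Q (ρ x) := by
    simp only [← Scheme.Hom.comp_apply, τ, s, pullback.lift_fst]
  have hsnd (x : Spec (.of T)) : pullback.fst M'.toSpec ρ'
      (pullback.snd (pullback.snd M.toSpec ρ) (pullback.snd M'.toSpec ρ') (τ x)) =
      M'.extension Q (ρ' x) := by
    simp only [← Scheme.Hom.comp_apply, τ, s', pullback.lift_fst, pullback.lift_snd]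
  have hid (x : Spec (.of T)) : (pullback.fst (pullback.snd M.toSpec ρ)
      (pullback.snd M'.toSpec ρ') ≫ pullback.snd M.toSpec ρ) (τ x) = x := by
    rw [← Scheme.Hom.comp_apply, pullback.lift_fst_assoc, pullback.lift_snd]
    rfl
  have key := H (τ t) ?_ ((congrArg (· ∈ (M.closure D).support) (hfst t)).mpr hQ)
    (fun hmem => hcon ((congrArg (· ∈ (M'.closure D).support) (hsnd t)).mp hmem))
  · exact hgt (hid t ▸ key)
  -- The generic point is dense in `Spec T` and `τ` sends it into the image of `X`, so `τ t` lies in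
  -- the closure of that image.
  · refine closure_mono ?_ (image_closure_subset_closure_image τ.continuous
      (Set.mem_image_of_mem _ (hdense t)))
    rintro _ ⟨_, ⟨x, rfl⟩, rfl⟩
    exact ⟨Q.1 x, by rw [← Scheme.Hom.comp_apply, ← Scheme.Hom.comp_apply, hτ]⟩

end

/-! ### Places and a common overring of `R` and `R'` -/

open IsDedekindDomain

theorem isFractionRing_subalgebra {R K : Type*} [CommRing R] [Field K] [Algebra R K]
    [IsFractionRing R K] (T : Subalgebra R K) : IsFractionRing T K := by
  refine IsFractionRing.of_field T K fun z => ?_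
  obtain ⟨x, y, -, rfl⟩ := IsFractionRing.div_surjective (A := R) z
  exact ⟨algebraMap R T x, algebraMap R T y, rfl⟩

theorem isNoetherianRing_adjoin_singleton {R K : Type*} [CommRing R] [IsNoetherianRing R]
    [Field K] [Algebra R K] (x : K) :
    IsNoetherianRing (Algebra.adjoin R {x}) :=
  haveI : Algebra.FiniteType R (Algebra.adjoin R {x}) :=
    (Subalgebra.fg_iff_finiteType _).mp (by
      simpa using Subalgebra.fg_adjoin_finset (R := R) {x})
  Algebra.FiniteType.isNoetherianRing R _

section

variable {K : Type u} [Field K]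
  {R : Type u} [CommRing R] [IsDedekindDomain R] [Algebra R K] [IsFractionRing R K]
  {R' : Type u} [CommRing R'] [IsDedekindDomain R'] [Algebra R' K] [IsFractionRing R' K]

theorem isEquiv_of_placeOf_eq {𝔭 : HeightOneSpectrum R} {𝔮 : HeightOneSpectrum R'}
    (h : placeOf K 𝔭 = placeOf K 𝔮) : (𝔭.valuation K).IsEquiv (𝔮.valuation K) :=
  (Valuation.isEquiv_iff_valuationSubring _ _).mpr h

theorem placeOf_injective : Function.Injective (placeOf K : HeightOneSpectrum R → _) := by
  intro 𝔭 𝔮 h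
  ext r
  rw [← HeightOneSpectrum.valuation_lt_one_iff_mem (K := K) 𝔭,
    ← HeightOneSpectrum.valuation_lt_one_iff_mem (K := K) 𝔮]
  exact (isEquiv_of_placeOf_eq h).lt_one_iff_lt_one

/-- Elements of `K` that are integral away from finitely many primes of `R` have a common
denominator, up to powers. -/
theorem exists_forall_mem_adjoin_inv {S : Set (HeightOneSpectrum R)} (hS : S.Finite) :
    ∃ f : R, f ≠ 0 ∧ ∀ x : K, (∀ 𝔭 ∉ S, 𝔭.valuation K x ≤ 1) →
      x ∈ Algebra.adjoin R {(algebraMap R K f)⁻¹} := by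
  choose a ha ha' using fun 𝔭 : HeightOneSpectrum R => Submodule.exists_mem_ne_zero_of_ne_bot 𝔭.ne_bot
  -- `f` lies in every prime of `S`, so a high power of it clears the poles of `x` there.
  let f := ∏ 𝔭 ∈ hS.toFinset, a 𝔭
  have hf : f ≠ 0 := Finset.prod_ne_zero_iff.mpr fun 𝔭 _ => ha' 𝔭
  have hfK : algebraMap R K f ≠ 0 := by simpa using hf
  have hfS (𝔭) (h : 𝔭 ∈ S) : 𝔭.valuation K (algebraMap R K f) < 1 := by
    rw [HeightOneSpectrum.valuation_lt_one_iff_mem]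
    exact Ideal.mem_of_dvd _ (Finset.dvd_prod_of_mem a (hS.mem_toFinset.mpr h)) (ha 𝔭)
  refine ⟨f, hf, fun x hx => ?_⟩
  have hpow (𝔭) (h : 𝔭 ∈ S) :
      ∃ n : ℕ, 𝔭.valuation K (algebraMap R K f) ^ n * 𝔭.valuation K x ≤ 1 := by
    have h0 : 𝔭.valuation K (algebraMap R K f) ≠ 0 := (Valuation.ne_zero_iff _).mpr hfK
    obtain ⟨n, hn⟩ := MulArchimedean.arch (𝔭.valuation K x)
      ((one_lt_inv₀ (zero_lt_iff.mpr h0)).mpr (hfS 𝔭 h))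
    refine ⟨n, ?_⟩
    calc _ ≤ 𝔭.valuation K (algebraMap R K f) ^ n * (𝔭.valuation K (algebraMap R K f))⁻¹ ^ n := by
          gcongr
      _ = 1 := by rw [← mul_pow, mul_inv_cancel₀ h0, one_pow]
  choose! n hn using hpow
  let N := hS.toFinset.sup n
  obtain ⟨r, hr⟩ := HeightOneSpectrum.mem_integers_of_valuation_le_one (R := R) K
      (algebraMap R K f ^ N * x) fun 𝔭 => by
    rw [map_mul, map_pow]
    by_cases h : 𝔭 ∈ S
    · refine le_trans ?_ (hn 𝔭 h)
      gcongr ?_ * _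
      exact pow_le_pow_right_of_le_one' (hfS 𝔭 h).le (Finset.le_sup (hS.mem_toFinset.mpr h))
    · exact mul_le_one' (pow_le_one' (𝔭.valuation_le_one f) _) (hx 𝔭 h)
  have hx' : x = algebraMap R K r * (algebraMap R K f)⁻¹ ^ N := by
    rw [hr, inv_pow, mul_comm, inv_mul_cancel_left₀ (pow_ne_zero _ hfK)]
  rw [hx']
  exact mul_mem (Subalgebra.algebraMap_mem _ r)
    (pow_mem (Algebra.subset_adjoin (Set.mem_singleton _)) N)

/-- The centre of a valuation on a ring on which it is bounded by `1`. -/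
def valuationCentre {T Γ : Type*} [CommRing T] [Algebra T K] [LinearOrderedCommGroupWithZero Γ]
    (v : Valuation K Γ) (h : ∀ x : T, v (algebraMap T K x) ≤ 1) : PrimeSpectrum T where
  asIdeal :=
    { carrier := {x | v (algebraMap T K x) < 1}
      zero_mem' := by simp
      add_mem' := fun {x y} hx hy => by
        rw [Set.mem_ofPred_eq, map_add]
        exact v.map_add_lt hx hy
      smul_mem' := fun c x hx => by
        rw [Set.mem_ofPred_eq, smul_eq_mul, map_mul, map_mul]
        exact (mul_le_of_le_one_left' (h c)).trans_lt hx }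
  isPrime := by
    refine ⟨fun h1 => ?_, fun {x y} hxy => ?_⟩
    · have := (Ideal.eq_top_iff_one _).mp h1
      change v (algebraMap T K 1) < 1 at this
      simp at this
    · by_contra! hcon
      obtain ⟨hx, hy⟩ := hcon
      replace hx : 1 ≤ v (algebraMap T K x) := not_lt.mp hx
      replace hy : 1 ≤ v (algebraMap T K y) := not_lt.mp hy
      replace hxy : v (algebraMap T K (x * y)) < 1 := hxy
      rw [map_mul, map_mul] at hxy
      exact hxy.not_ge (one_le_mul hx hy)

/-! ### Finiteness of the bad places and of the symmetric difference -/

variable {X : Scheme.{u}} {p : X ⟶ Spec (.of K)}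

/-- Two models see the same intersections at almost all of their common places. -/
theorem IntegralModel.finite_setOf_dvd_not_dvd (M : IntegralModel p R) (M' : IntegralModel p R')
    (D : X.IdealSheafData)
    (hfin : {𝔭 : HeightOneSpectrum R | ∀ 𝔮 : HeightOneSpectrum R',
      placeOf K 𝔭 ≠ placeOf K 𝔮}.Finite) :
    {V : ValuationSubring K | ∃ (𝔭 : HeightOneSpectrum R) (𝔮 : HeightOneSpectrum R'),
      placeOf K 𝔭 = V ∧ placeOf K 𝔮 = V ∧ ∃ Q : RationalPoint p,
        𝔭.asIdeal ∣ M.intersectionIdeal D Q ∧ ¬ 𝔮.asIdeal ∣ M'.intersectionIdeal D Q}.Finite := by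
  obtain ⟨f, hf, hadj⟩ := exists_forall_mem_adjoin_inv (K := K) hfin
  let T := Algebra.adjoin R {(algebraMap R K f)⁻¹}
  have : IsFractionRing T K := isFractionRing_subalgebra T
  have : IsNoetherianRing T := isNoetherianRing_adjoin_singleton _
  have hR' (x : R') : algebraMap R' K x ∈ T := hadj _ fun 𝔭 h𝔭 => by
    simp only [Set.mem_ofPred_eq, not_forall, not_not] at h𝔭
    obtain ⟨𝔮, h𝔮⟩ := h𝔭
    exact (isEquiv_of_placeOf_eq h𝔮).le_one_iff_le_one.mpr (𝔮.valuation_le_one x)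
  let : Algebra R' T := ((algebraMap R' K).codRestrict T hR').toAlgebra
  have : IsScalarTower R' T K := .of_algebraMap_eq fun _ => rfl
  obtain ⟨g, hg, H⟩ := M.exists_ne_zero_of_mem_support T M' D
  have hgK : (g : K) ≠ 0 := by simpa using hg
  -- At a prime where neither `f⁻¹` nor `g⁻¹` has a pole, the valuation is bounded by `1` on `T` and
  -- `g` is a unit for it.
  refine (((HeightOneSpectrum.Support.finite R (algebraMap R K f)⁻¹).union
    (HeightOneSpectrum.Support.finite R (g : K)⁻¹)).image (placeOf K)).subset ?_
  rintro V ⟨𝔭, 𝔮, h𝔭, h𝔮, Q, h, h'⟩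
  refine ⟨𝔭, ?_, h𝔭⟩
  by_contra hcon
  simp only [HeightOneSpectrum.Support, Set.mem_union, Set.mem_ofPred_eq, not_or, not_lt] at hcon
  have hv := isEquiv_of_placeOf_eq (h𝔭.trans h𝔮.symm)
  have hT (x : T) : 𝔭.valuation K (algebraMap T K x) ≤ 1 := by
    obtain ⟨x, hx⟩ := x
    change 𝔭.valuation K x ≤ 1
    induction hx using Algebra.adjoin_induction with
    | mem x hx => exact Set.mem_singleton_iff.mp hx ▸ hcon.1
    | algebraMap r => exact 𝔭.valuation_le_one r
    | add x y _ _ hx hy => exact (𝔭.valuation K).map_add_le hx hy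
    | mul x y _ _ hx hy => exact (map_mul (𝔭.valuation K) x y).trans_le (mul_le_one' hx hy)
  -- The common place determines one prime of `T` lying over both `𝔭` and `𝔮`, where the two
  -- sections can be compared.
  let t := valuationCentre (𝔭.valuation K) hT
  have ht : t.comap (algebraMap R T) = ⟨𝔭.asIdeal, 𝔭.isPrime⟩ := by
    ext r
    exact 𝔭.valuation_lt_one_iff_mem r
  have ht' : t.comap (algebraMap R' T) = ⟨𝔮.asIdeal, 𝔮.isPrime⟩ := by
    ext r
    exact hv.lt_one_iff_lt_one.trans (𝔮.valuation_lt_one_iff_mem r)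
  have hgt : g ∉ t.asIdeal := by
    intro hgt
    replace hgt : 𝔭.valuation K (g : K) < 1 := hgt
    have := mul_lt_one_of_lt_of_le hgt hcon.2
    rw [← map_mul, mul_inv_cancel₀ hgK, map_one] at this
    exact this.false
  refine h' ((M'.dvd_intersectionIdeal_iff D Q ⟨𝔮.asIdeal, 𝔮.isPrime⟩).mpr ?_)
  rw [← ht']
  refine H Q t hgt ?_
  rw [ht]
  exact (M.dvd_intersectionIdeal_iff D Q ⟨𝔭.asIdeal, 𝔭.isPrime⟩).mp h

theorem HasAlmostAllPlaces.finite_setOf_placeOf_ne {C : Subring K} (hR : HasAlmostAllPlaces C R)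
    (hR' : HasAlmostAllPlaces C R') :
    {𝔭 : HeightOneSpectrum R | ∀ 𝔮 : HeightOneSpectrum R', placeOf K 𝔭 ≠ placeOf K 𝔮}.Finite :=
  (hR'.finite_compl.preimage placeOf_injective.injOn).subset fun 𝔭 h𝔭 => ⟨hR.isPlace 𝔭, h𝔭⟩

/-- An index in the difference has a primitive divisor `𝔮` for `M'`. If `𝔮` were a place of `R` at
which both models see the same intersections, it would give a primitive divisor for `M`. Both
directions of the comparison are needed: one for divisibility at `n`, the other for non-divisibility
at `m < n`. -/
theorem IntegralModel.finite_zsigmondySet_sdiff {C : Subring K} (hR : HasAlmostAllPlaces C R)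
    (hR' : HasAlmostAllPlaces C R') (M : IntegralModel p R) (M' : IntegralModel p R')
    (D : X.IdealSheafData) (Q : ℕ → RationalPoint p) :
    (M.zsigmondySet D Q \ M'.zsigmondySet D Q).Finite := by
  have hfin := hR'.finite_setOf_placeOf_ne hR
  have hfin₁ := (M.finite_setOf_dvd_not_dvd M' D (hR.finite_setOf_placeOf_ne hR')).preimage
    (placeOf_injective (R := R')).injOn
  have hfin₂ := (M'.finite_setOf_dvd_not_dvd M D hfin).preimage
    (placeOf_injective (R := R')).injOn
  refine ((hfin.union (hfin₁.union hfin₂)).biUnion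
    (t := fun 𝔮 => {n | M'.IsPrimitiveDivisor D Q n 𝔮}) fun 𝔮 _ => ?_).subset ?_
  -- A prime is primitive only at the first index where it divides.
  · refine Set.Subsingleton.finite fun m hm n hn => ?_
    rcases lt_trichotomy m n with h | h | h
    · exact absurd hm.1 (hn.2 m h)
    · exact h
    · exact absurd hn.1 (hm.2 n h)
  · rintro n ⟨hn, hn'⟩
    obtain ⟨𝔮, h𝔮⟩ := not_not.mp hn'
    refine Set.mem_biUnion (x := 𝔮) ?_ h𝔮
    by_contra hcon
    simp only [Set.mem_union, not_or] at hcon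
    obtain ⟨h, h₁, h₂⟩ := hcon
    simp only [Set.mem_ofPred_eq, not_forall, not_not] at h
    obtain ⟨𝔭, h𝔭⟩ := h
    refine hn ⟨𝔭, ?_, fun m hm h𝔭m => ?_⟩
    · by_contra h'
      exact h₂ ⟨𝔮, 𝔭, rfl, h𝔭.symm, Q n, h𝔮.1, h'⟩
    · exact h₁ ⟨𝔭, 𝔮, h𝔭.symm, rfl, Q m, h𝔭m, h𝔮.2 m hm⟩

end

end Zsigmondy

theorem mainTheorem4 {K : Type u} [Field K] (C : Subring K) (hK : Zsigmondy.IsBaseField K C)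
    {X : Scheme.{u}} (p : X ⟶ Spec (.of K)) (hX : Zsigmondy.IsSmoothProjectiveVariety p)
    (D : X.IdealSheafData) (hD : Zsigmondy.IsEffectiveDivisor D)
    (Q : ℕ → Zsigmondy.RationalPoint p) (hQ : ∀ n, (Q n).NotMemSupport D)
    (R : Type u) [CommRing R] [IsDedekindDomain R] [Algebra R K] [IsFractionRing R K]
    (hR : Zsigmondy.HasAlmostAllPlaces C R)
    (R' : Type u) [CommRing R'] [IsDedekindDomain R'] [Algebra R' K] [IsFractionRing R' K]
    (hR' : Zsigmondy.HasAlmostAllPlaces C R')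
    (M : Zsigmondy.IntegralModel p R) (M' : Zsigmondy.IntegralModel p R') :
    ((M.zsigmondySet D Q ∪ M'.zsigmondySet D Q) \
        (M.zsigmondySet D Q ∩ M'.zsigmondySet D Q)).Finite ∧
      ((M.zsigmondySet D Q).Finite ↔ (M'.zsigmondySet D Q).Finite) := by
  have h := M.finite_zsigmondySet_sdiff hR hR' M' D Q
  have h' := M'.finite_zsigmondySet_sdiff hR' hR M D Q
  refine ⟨(h.union h').subset ?_, fun hM => (h'.union hM).subset ?_,
    fun hM => (h.union hM).subset ?_⟩
  · rintro n ⟨hn | hn, hn'⟩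
    · exact .inl ⟨hn, fun h => hn' ⟨hn, h⟩⟩
    · exact .inr ⟨hn, fun h => hn' ⟨h, hn⟩⟩
  all_goals
    rw [Set.sdiff_union_self]
    exact Set.subset_union_left
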